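/- Let $r>0$, $\mu>r$, $\sigma>0$, $\beta>0$, $\alpha\in(0,1)$, $\gamma^*>0$, $Y>0$ and $0<\underline L<\overline L$ be constants, and put $\theta:=(\mu-r)/\sigma$ and $A(l):=e^{-\gamma^*(1-\alpha)l}$. Let $(B_t)_{t\ge 0}$ be a standard Brownian motion on a filtered probability space $(\Omega,\mathcal F,(\mathcal F_t)_{t\ge 0},\mathbb P)$ satisfying the usual conditions. Let $U(c,l):=-\frac{1}{\alpha\gamma^*}e^{-\gamma^*\{\alpha c+(1-\alpha)l\}}$ and, for $y>0$, $$\underline U(y):=\sup_{c\ge 0}\bigl(U(c,\underline L)-cy\bigr),\qquad \overline U(y):=\sup_{c\ge 0}\bigl(U(c,\overline L)-cy\bigr),\qquad g(y):=\underline U(y)-\overline U(y)+Yy .$$ For $y>0$ let $y_t:=y\,e^{\beta t}H_t$ with $H_t:=e^{-(r+\theta^2/2)t-\theta B_t}$, and consider the optimal stopping problem $$J(y,\tau):=\mathbb E\Bigl[\int_0^\tau e^{-\beta s}g(y_s)\,ds\Bigr],\qquad \tilde w(y):=\sup_\tau J(y,\tau),$$ the supremum being over all $(\mathcal F_t)$-stopping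 times $\tau$ with values in $[0,\infty]$. The retirement threshold $\overline y\in[0,\infty]$ is the supremum of the set of all $y>0$ with $\tilde w(y)=0$, that is, of the starting points from which immediate retirement $\tau=0$ is optimal ($\overline y:=0$ if there is none). For $b\in[0,\infty]$ put $\tau_b:=\inf\{s\ge 0: y_s\le b\}$ (so $\tau_0=\infty$ and $\tau_\infty=0$), and call $b$ an optimal threshold if $J(y,\tau_b)=\tilde w(y)$ for every $y>0$. Then: 1. For every $y>0$, $\mathbb E\int_0^\infty e^{-\beta s}|g(y_s)|\,ds<\infty$; and $\tilde w(y)=0$ if and only if $y\le\overline y$. 2. $\overline y<\infty$. 3. If $Y\ge\frac{1-\alpha}{\alpha}(\overline L-\underline L)$, then $\overline y=0$; moreover $g(y)\ge 0$ for all $y>0$, and $0$ is an optimal threshold, i.e. never retiring ($\tau=\infty$) is optimal from every $y>0$. 4. If $Y<\frac{1-\alpha}{\alpha}(\overline L-\underline L)$, then there is a unique $j>A(\overline L)$ such that $g<0$ on $(0,j)$, $g(j)=0$ and $g>0$ on $(j,\infty)$; and for every $y>j$ the time $\tau_j=\inf\{s\ge 0:y_s\le j\}$ is a stopping time with $J(y,\tau_j)>0$.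 5. Every optimal threshold $b\in[0,\infty]$ satisfies $b<\infty$, and $b=0$ if $Y\ge\frac{1-\alpha}{\alpha}(\overline L-\underline L)$. -/

import Mathlib

open MeasureTheory ProbabilityTheory
open scoped NNReal ENNReal

noncomputable section

/-- Constants of the market and of the agent. -/
structure RetirementModel where
  /-- risk-free rate -/
  r : ℝ
  /-- drift of the stock -/
  μ : ℝ
  /-- volatility of the stock -/
  σ : ℝ
  /-- subjective discount rate -/
  β : ℝ
  /-- weight of consumption in the utility -/
  α : ℝ
  /-- risk aversion -/
  γstar : ℝ
  /-- labor income per unit of time before retirement -/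
  Y : ℝ
  /-- leisure rate before retirement -/
  Llow : ℝ
  /-- leisure rate after retirement -/
  Lhigh : ℝ
  r_pos : 0 < r
  r_lt_μ : r < μ
  σ_pos : 0 < σ
  β_pos : 0 < β
  α_pos : 0 < α
  α_lt_one : α < 1
  γstar_pos : 0 < γstar
  Y_pos : 0 < Y
  Llow_pos : 0 < Llow
  Llow_lt_Lhigh : Llow < Lhigh

namespace RetirementModel

/-- Sharpe ratio. -/
def θ (M : RetirementModel) : ℝ := (M.μ - M.r) / M.σ

/-- `A(l) = exp (-γ* (1 - α) l)`. -/
def A (M : RetirementModel) (l : ℝ) : ℝ := Real.exp (-(M.γstar * (1 - M.α) * l))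

/-- Utility of consumption rate `c` and leisure rate `l`. -/
def utility (M : RetirementModel) (c l : ℝ) : ℝ :=
  -(Real.exp (-(M.γstar * (M.α * c + (1 - M.α) * l))) / (M.α * M.γstar))

/-- The dual utility `sup_{c ≥ 0} (U(c, l) - c y)`; for `y > 0` (the only case that matters) this
is the supremum of a nonempty set that is bounded above by `0`. -/
def dualUtility (M : RetirementModel) (l y : ℝ) : ℝ :=
  sSup ((fun c : ℝ => M.utility c l - c * y) '' Set.Ici 0)

/-- Net running gain from working: pre-retirement minus post-retirement dual utility, plus the
income `Y y`. -/
def gain (M : RetirementModel) (y : ℝ) : ℝ :=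
  M.dualUtility M.Llow y - M.dualUtility M.Lhigh y + M.Y * y

/-- The income level `((1 - α) / α) (Lhigh - Llow)`. -/
def criticalIncome (M : RetirementModel) : ℝ := (1 - M.α) / M.α * (M.Lhigh - M.Llow)

section Stochastic

variable {Ω : Type*} {mΩ : MeasurableSpace Ω}

/-- The state price density `H_t = exp (-(r + θ² / 2) t - θ B_t)`. -/
def stateDensity (M : RetirementModel) (B : ℝ≥0 → Ω → ℝ) (t : ℝ≥0) (ω : Ω) : ℝ :=
  Real.exp (-(M.r + M.θ ^ 2 / 2) * t - M.θ * B t ω)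

/-- The dual process `y_t = y e^{β t} H_t` started from `y`. -/
def dualState (M : RetirementModel) (B : ℝ≥0 → Ω → ℝ) (y : ℝ) (t : ℝ≥0) (ω : Ω) : ℝ :=
  y * Real.exp (M.β * t) * M.stateDensity B t ω

/-- The discounted running gain `e^{-β s} gain(y_s)` at the real time `s ≥ 0`. -/
def runningGain (M : RetirementModel) (B : ℝ≥0 → Ω → ℝ) (y : ℝ) (ω : Ω) (s : ℝ) : ℝ :=
  Real.exp (-(M.β * s)) * M.gain (M.dualState B y s.toNNReal ω)

/-- `E^y [∫_0^τ e^{-β s} gain(y_s) ds]`. -/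
def reward (M : RetirementModel) (P : Measure Ω) (B : ℝ≥0 → Ω → ℝ) (y : ℝ)
    (τ : Ω → WithTop ℝ≥0) : ℝ :=
  ∫ ω, (∫ s in {s : ℝ | 0 ≤ s ∧ (s.toNNReal : WithTop ℝ≥0) < τ ω}, M.runningGain B y ω s) ∂P

/-- The value of the optimal stopping problem: the supremum of the reward over all stopping
times (possibly infinite), taken in the extended reals. -/
def value (M : RetirementModel) (P : Measure Ω) (𝓕 : Filtration ℝ≥0 mΩ) (B : ℝ≥0 → Ω → ℝ)
    (y : ℝ) : EReal :=
  ⨆ (τ : Ω → WithTop ℝ≥0) (_ : IsStoppingTime 𝓕 τ), (M.reward P B y τ : EReal)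

/-- The rule `inf {s ≥ 0 : y_s ≤ b}` with threshold `b ∈ [0, ∞]` (never stop if `b = 0`, stop at
time `0` if `b = ∞`). -/
def thresholdTime (M : RetirementModel) (B : ℝ≥0 → Ω → ℝ) (y : ℝ) (b : ℝ≥0∞) :
    Ω → WithTop ℝ≥0 :=
  hittingAfter (M.dualState B y) {z : ℝ | ENNReal.ofReal z ≤ b} 0

/-- From every starting point, stopping at the threshold `b` attains the supremum. -/
def IsOptimalThreshold (M : RetirementModel) (P : Measure Ω) (𝓕 : Filtration ℝ≥0 mΩ)
    (B : ℝ≥0 → Ω → ℝ) (b : ℝ≥0∞) : Prop :=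
  ∀ y : ℝ, 0 < y → (M.reward P B y (M.thresholdTime B y b) : EReal) = M.value P 𝓕 B y

/-- The starting points from which the value is `0`, i.e. from which immediate retirement
(`τ = 0`) is optimal. -/
def retirementRegion (M : RetirementModel) (P : Measure Ω) (𝓕 : Filtration ℝ≥0 mΩ)
    (B : ℝ≥0 → Ω → ℝ) : Set ℝ :=
  {y : ℝ | 0 < y ∧ M.value P 𝓕 B y = 0}

/-- The retirement threshold, the supremum in `[0, ∞]` of the region of immediate retirement
(`0` if the region is empty). -/
def retirementThreshold (M : RetirementModel) (P : Measure Ω) (𝓕 : Filtration ℝ≥0 mΩ)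
    (B : ℝ≥0 → Ω → ℝ) : ℝ≥0∞ :=
  ⨆ y ∈ M.retirementRegion P 𝓕 B, ENNReal.ofReal y

end Stochastic

end RetirementModel

/-- `B` is a standard Brownian motion with respect to the filtration `𝓕`. -/
structure IsFiltrationBrownian {Ω : Type*} {mΩ : MeasurableSpace Ω} (P : Measure Ω)
    (𝓕 : Filtration ℝ≥0 mΩ) (B : ℝ≥0 → Ω → ℝ) : Prop where
  brownian : IsBrownianReal B P
  adapted : Adapted 𝓕 B
  indep : ∀ s t : ℝ≥0, s ≤ t →
    Indep (MeasurableSpace.comap (fun ω => B t ω - B s ω) inferInstance) (𝓕 s) P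

/-- The usual conditions: right-continuity, and all `P`-null sets belong to `𝓕 0`. -/
structure UsualConditions {Ω : Type*} {mΩ : MeasurableSpace Ω} (P : Measure Ω)
    (𝓕 : Filtration ℝ≥0 mΩ) : Prop where
  rightContinuous : 𝓕.IsRightContinuous
  complete : ∀ s : Set Ω, P s = 0 → MeasurableSet[𝓕 0] s

end

/-! Write `gain y = y * gainRate y`. The rate is constant, equal to `Y - criticalIncome`, up to `A
Lhigh`, strictly increasing afterwards, and bounded above by `Y`. This settles the sign of the gain
in both income regimes (`gain_nonneg`, `exists_sign_change`).

The discounting cancels the factor `e^{βs}` of the dual state, so the running gain is `y H_s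
gainRate (y_s)` (`runningGain_eq`). As the rate is bounded and `E H_s = e^{-rs}`, it is integrable
over scenarios and times. For a fixed stopping time `τ`, `J(y, τ) / y` is nondecreasing in `y`,
because `y_s` is (`reward_div_mono`), and `J(·, τ)` is continuous (`continuousAt_reward`). Hence the
points of value zero form an initial interval of `(0, ∞)`, closed in it.

The threshold is finite once some stopping time has positive reward from some point: never stopping
if income is high (`reward_top_pos`), waiting for the zero `j` of the gain otherwise
(`reward_thresholdTime_pos`). An optimal threshold `b` forces value zero at every `y ≤ b`, so the
same positive rewards control `b`. -/

namespace RetirementModel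

/-! ### Dual utility and sign of the gain. -/

variable (M : RetirementModel)

lemma A_pos (l : ℝ) : 0 < M.A l := Real.exp_pos _

lemma log_A (l : ℝ) : Real.log (M.A l) = -(M.γstar * (1 - M.α) * l) := Real.log_exp _

lemma A_Lhigh_lt_A_Llow : M.A M.Lhigh < M.A M.Llow := by
  have h1 := M.α_lt_one
  have h2 := M.Llow_lt_Lhigh
  have h3 : 0 < M.γstar * (1 - M.α) := mul_pos M.γstar_pos (by linarith)
  exact Real.exp_lt_exp.2 (by nlinarith)

lemma α_mul_γstar_pos : 0 < M.α * M.γstar := mul_pos M.α_pos M.γstar_pos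

lemma criticalIncome_pos : 0 < M.criticalIncome :=
  mul_pos (div_pos (sub_pos.2 M.α_lt_one) M.α_pos) (sub_pos.2 M.Llow_lt_Lhigh)

/-- In the variable `x = α γ* c`, maximising over `c ≥ 0` means minimising the convex function `A(l)
e^{-x} + x y` over `x ≥ 0`; the minimiser is `max 0 (log (A(l) / y))`. -/
lemma utility_sub (c l y : ℝ) : M.utility c l - c * y =
    -((M.A l * Real.exp (-(M.α * M.γstar * c)) + M.α * M.γstar * c * y) / (M.α * M.γstar)) := by
  have := M.α_mul_γstar_pos.ne'
  rw [utility, A, ← Real.exp_add, add_div, mul_assoc _ c y, mul_div_cancel_left₀ _ this]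
  ring_nf

/-- Closed form of the dual utility. -/
lemma dualUtility_eq (l : ℝ) {y : ℝ} (hy : 0 < y) : M.dualUtility l y =
    -((M.A l * Real.exp (-max 0 (Real.log (M.A l / y))) + max 0 (Real.log (M.A l / y)) * y) /
      (M.α * M.γstar)) := by
  have hk := M.α_mul_γstar_pos
  have hA := M.A_pos l
  set m := max 0 (Real.log (M.A l / y)) with hm
  refine IsGreatest.csSup_eq ⟨⟨m / (M.α * M.γstar), div_nonneg (le_max_left _ _) hk.le, ?_⟩, ?_⟩
  · simp only [utility_sub]
    rw [mul_div_cancel₀ _ hk.ne']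
  · rintro _ ⟨c, hc, rfl⟩
    simp only [utility_sub]
    have hx : 0 ≤ M.α * M.γstar * c := mul_nonneg hk.le hc
    set x := M.α * M.γstar * c
    rw [neg_le_neg_iff, div_le_div_iff_of_pos_right hk]
    -- First-order condition at `m`: the slope `y - A(l) e^{-m}` is nonnegative, and zero when `m`
    -- is interior.
    have hle : M.A l * Real.exp (-m) ≤ y := by
      have : M.A l / y ≤ Real.exp m := by
        rw [← Real.exp_log (div_pos hA hy)]
        exact Real.exp_le_exp.2 (le_max_right _ _)
      rw [Real.exp_neg, ← div_eq_mul_inv, div_le_iff₀ (Real.exp_pos _), mul_comm]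
      exact (div_le_iff₀ hy).1 this
    have hexp : M.A l * Real.exp (-x) = M.A l * Real.exp (-m) * Real.exp (m - x) := by
      rw [mul_assoc, ← Real.exp_add]; ring_nf
    -- A convex function lies above its tangent at `m`.
    have h1 : M.A l * Real.exp (-m) * (m - x + 1) ≤ M.A l * Real.exp (-x) := by
      rw [hexp]
      exact mul_le_mul_of_nonneg_left (Real.add_one_le_exp _) (by positivity)
    rcases le_total (Real.log (M.A l / y)) 0 with h | h
    · have : m = 0 := max_eq_left h
      rw [this] at h1 hle ⊢
      nlinarith
    · have : m = Real.log (M.A l / y) := max_eq_right h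
      have : M.A l * Real.exp (-m) = y := by
        rw [this, Real.exp_neg, Real.exp_log (div_pos hA hy)]
        field_simp
      rw [this] at h1 ⊢
      nlinarith

lemma dualUtility_of_le (l : ℝ) {y : ℝ} (hy : 0 < y) (h : y ≤ M.A l) :
    M.dualUtility l y = -(y * (1 + Real.log (M.A l) - Real.log y) / (M.α * M.γstar)) := by
  have hA := M.A_pos l
  rw [dualUtility_eq M l hy, max_eq_right (Real.log_nonneg ((one_le_div hy).2 h)), Real.exp_neg,
    Real.exp_log (div_pos hA hy), Real.log_div hA.ne' hy.ne']
  congr 2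
  field_simp
  ring

lemma dualUtility_of_ge (l : ℝ) {y : ℝ} (h : M.A l ≤ y) :
    M.dualUtility l y = -(M.A l / (M.α * M.γstar)) := by
  have hA := M.A_pos l
  have hy := hA.trans_le h
  rw [dualUtility_eq M l hy,
    max_eq_left (Real.log_nonpos (div_pos hA hy).le ((div_le_one hy).2 h))]
  simp

/-- The gain per unit of the dual state. -/
noncomputable def gainRate (y : ℝ) : ℝ := M.gain y / y

lemma gainRate_of_le {y : ℝ} (hy : 0 < y) (h : y ≤ M.A M.Lhigh) :
    M.gainRate y = M.Y - M.criticalIncome := by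
  have hk := M.α_mul_γstar_pos
  have := M.α_pos
  have := M.γstar_pos
  rw [gainRate, gain, dualUtility_of_le M _ hy h,
    dualUtility_of_le M _ hy (h.trans M.A_Lhigh_lt_A_Llow.le), log_A, log_A, criticalIncome]
  field_simp
  ring

lemma gainRate_of_mem_Icc {y : ℝ} (h₁ : M.A M.Lhigh ≤ y) (h₂ : y ≤ M.A M.Llow) :
    M.gainRate y = M.Y -
      (1 + Real.log (M.A M.Llow) - Real.log y - M.A M.Lhigh / y) / (M.α * M.γstar) := by
  have hk := M.α_mul_γstar_pos
  have hy := (M.A_pos M.Lhigh).trans_le h₁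
  rw [gainRate, gain, dualUtility_of_le M _ hy h₂, dualUtility_of_ge M _ h₁]
  field_simp
  ring

lemma gainRate_of_ge {y : ℝ} (h : M.A M.Llow ≤ y) :
    M.gainRate y = M.Y - (M.A M.Llow - M.A M.Lhigh) / (M.α * M.γstar) / y := by
  have hk := M.α_mul_γstar_pos
  have hy := (M.A_pos M.Llow).trans_le h
  rw [gainRate, gain, dualUtility_of_ge M _ h,
    dualUtility_of_ge M _ (M.A_Lhigh_lt_A_Llow.le.trans h)]
  field_simp
  ring

/-- On the middle interval the rate is, up to constants, `log y + A(Lhigh) / y`, which increases for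
`y > A(Lhigh)`: `log` gains more than `1 - x / y`, and the other term loses at most that. -/
lemma strictMonoOn_gainRate : StrictMonoOn M.gainRate (Set.Ici (M.A M.Lhigh)) := by
  have hk := M.α_mul_γstar_pos
  have ha := M.A_pos M.Lhigh
  have hlt := M.A_Lhigh_lt_A_Llow
  rw [← Set.Icc_union_Ici_eq_Ici hlt.le]
  refine StrictMonoOn.union (c := M.A M.Llow) ?_ ?_ (isGreatest_Icc hlt.le) isLeast_Ici
  · rintro x ⟨hx₁, hx₂⟩ y ⟨hy₁, hy₂⟩ hxy
    have hx := ha.trans_le hx₁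
    have hy := ha.trans_le hy₁
    rw [gainRate_of_mem_Icc M hx₁ hx₂, gainRate_of_mem_Icc M hy₁ hy₂]
    have h1 : Real.log x - Real.log y < x / y - 1 := by
      rw [← Real.log_div hx.ne' hy.ne']
      exact Real.log_lt_sub_one_of_pos (div_pos hx hy) ((div_lt_one hy).2 hxy).ne
    have h2 : M.A M.Lhigh / x - M.A M.Lhigh / y ≤ 1 - x / y := by
      have : M.A M.Lhigh / x - M.A M.Lhigh / y = M.A M.Lhigh / x * (1 - x / y) := by field_simp
      rw [this]
      exact mul_le_of_le_one_left (sub_nonneg.2 ((div_le_one hy).2 hxy.le)) ((div_le_one hx).2 hx₁)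
    refine sub_lt_sub_left (div_lt_div_of_pos_right ?_ hk) _
    linarith
  · intro x hx y hy hxy
    rw [gainRate_of_ge M hx, gainRate_of_ge M hy]
    exact sub_lt_sub_left (div_lt_div_of_pos_left (div_pos (sub_pos.2 hlt) hk)
      ((M.A_pos _).trans_le hx) hxy) _

lemma monotoneOn_gainRate : MonotoneOn M.gainRate (Set.Ioi 0) := by
  have ha := M.A_pos M.Lhigh
  rw [← Set.Ioc_union_Ici_eq_Ioi ha]
  refine MonotoneOn.union_right (c := M.A M.Lhigh) ?_ M.strictMonoOn_gainRate.monotoneOn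
    ⟨⟨ha, le_rfl⟩, fun _ h => h.2⟩ isLeast_Ici
  rintro x ⟨hx₁, hx₂⟩ y ⟨hy₁, hy₂⟩ _
  rw [gainRate_of_le M hx₁ hx₂, gainRate_of_le M hy₁ hy₂]

lemma sub_criticalIncome_le_gainRate {y : ℝ} (hy : 0 < y) :
    M.Y - M.criticalIncome ≤ M.gainRate y := by
  have h := lt_min hy (M.A_pos M.Lhigh)
  rw [← gainRate_of_le M h (min_le_right _ _)]
  exact M.monotoneOn_gainRate h hy (min_le_left _ _)

lemma gainRate_le {y : ℝ} (hy : 0 < y) : M.gainRate y ≤ M.Y := by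
  refine (M.monotoneOn_gainRate hy (hy.trans_le (le_max_left _ (M.A M.Llow)))
    (le_max_left _ _)).trans ?_
  rw [gainRate_of_ge M (le_max_right _ _)]
  exact sub_le_self _ (div_nonneg (div_nonneg (sub_nonneg.2 M.A_Lhigh_lt_A_Llow.le)
    M.α_mul_γstar_pos.le) (hy.le.trans (le_max_left _ _)))

lemma abs_gainRate_le {y : ℝ} (hy : 0 < y) : |M.gainRate y| ≤ M.Y + M.criticalIncome := by
  have := M.sub_criticalIncome_le_gainRate hy
  have := M.gainRate_le hy
  have := M.criticalIncome_pos
  have := M.Y_pos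
  exact abs_le.2 ⟨by linarith, by linarith⟩

lemma gain_eq_mul_gainRate {y : ℝ} (hy : 0 < y) : M.gain y = y * M.gainRate y :=
  (mul_div_cancel₀ _ hy.ne').symm

lemma continuousOn_gainRate : ContinuousOn M.gainRate (Set.Ioi 0) := by
  have (l : ℝ) : ContinuousOn (M.dualUtility l) (Set.Ioi 0) := by
    refine ContinuousOn.congr (f := fun y =>
      -((M.A l * Real.exp (-max 0 (Real.log (M.A l / y))) + max 0 (Real.log (M.A l / y)) * y) /
        (M.α * M.γstar))) ?_ fun y hy => dualUtility_eq M l hy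
    have : ContinuousOn (fun y => Real.log (M.A l / y)) (Set.Ioi 0) :=
      (continuousOn_const.div continuousOn_id fun y hy => ne_of_gt hy).log
        fun y hy => (div_pos (M.A_pos l) hy).ne'
    fun_prop
  exact (((this _).sub (this _)).add (by fun_prop)).div continuousOn_id fun y hy => ne_of_gt hy

lemma gain_pos_iff {y : ℝ} (hy : 0 < y) : 0 < M.gain y ↔ 0 < M.gainRate y := by
  rw [gain_eq_mul_gainRate M hy, mul_pos_iff_of_pos_left hy]

lemma gain_nonneg (h : M.criticalIncome ≤ M.Y) {y : ℝ} (hy : 0 < y) : 0 ≤ M.gain y := by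
  rw [gain_eq_mul_gainRate M hy]
  exact mul_nonneg hy.le ((sub_nonneg.2 h).trans (M.sub_criticalIncome_le_gainRate hy))

lemma gain_pos (h : M.criticalIncome ≤ M.Y) {y : ℝ} (hy : M.A M.Lhigh < y) : 0 < M.gain y := by
  have ha := M.A_pos M.Lhigh
  rw [gain_pos_iff M (ha.trans hy)]
  exact ((sub_nonneg.2 h).trans_eq (gainRate_of_le M ha le_rfl).symm).trans_lt
    (M.strictMonoOn_gainRate Set.self_mem_Ici hy.le hy)

lemma exists_sign_change (h : M.Y < M.criticalIncome) : ∃ j : ℝ, M.A M.Lhigh < j ∧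
    (∀ y, 0 < y → y < j → M.gain y < 0) ∧ M.gain j = 0 ∧ ∀ y, j < y → 0 < M.gain y := by
  have ha := M.A_pos M.Lhigh
  have hrate : M.gainRate (M.A M.Lhigh) < 0 := by
    rw [gainRate_of_le M ha le_rfl]; linarith
  set D := (M.A M.Llow - M.A M.Lhigh) / (M.α * M.γstar)
  have hlt := M.A_Lhigh_lt_A_Llow
  -- Beyond `A(Llow)` the rate is `Y - D / z`, nonnegative as soon as `z ≥ D / Y`; this is the right
  -- endpoint for the intermediate value theorem.
  obtain ⟨z, hz, hDz⟩ : ∃ z, M.A M.Llow ≤ z ∧ D / M.Y ≤ z := ⟨max _ _, le_max_left _ _, le_max_right _ _⟩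
  have hz0 : 0 < z := ha.trans (hlt.trans_le hz)
  have hzrate : 0 ≤ M.gainRate z := by
    exact (gainRate_of_ge M hz).symm ▸ sub_nonneg.2 ((div_le_iff₀ hz0).2 ((div_le_iff₀' M.Y_pos).1 hDz))
  obtain ⟨j, ⟨hj₁, -⟩, hj⟩ := intermediate_value_Icc (hlt.le.trans hz)
    (M.continuousOn_gainRate.mono fun x hx => ha.trans_le hx.1) ⟨hrate.le, hzrate⟩
  have haj : M.A M.Lhigh < j := lt_of_le_of_ne hj₁ (by rintro rfl; linarith)
  refine ⟨j, haj, fun y hy hyj => ?_, ?_, fun y hy => ?_⟩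
  · rw [gain_eq_mul_gainRate M hy]
    refine mul_neg_of_pos_of_neg hy ?_
    rcases le_total y (M.A M.Lhigh) with hya | hya
    · rw [gainRate_of_le M hy hya]; linarith
    · exact (M.strictMonoOn_gainRate hya hj₁ hyj).trans_eq hj
  · rw [gain_eq_mul_gainRate M (ha.trans haj), hj, mul_zero]
  · rw [gain_pos_iff M (ha.trans (haj.trans hy)), ← hj]
    exact M.strictMonoOn_gainRate hj₁ (haj.trans hy).le hy

end RetirementModel

/-! ### Measurability of the Brownian paths. -/

lemma IsFiltrationBrownian.measurableSet_not_continuous {Ω : Type*} {mΩ : MeasurableSpace Ω}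
    {P : Measure Ω} {𝓕 : Filtration ℝ≥0 mΩ} {B : ℝ≥0 → Ω → ℝ} (h𝓕 : UsualConditions P 𝓕)
    (hB : IsFiltrationBrownian P 𝓕 B) (t : ℝ≥0) :
    MeasurableSet[𝓕 t] {ω | ¬ Continuous (B · ω)} :=
  𝓕.mono (zero_le (a := t)) _ (h𝓕.complete _ hB.brownian.cont)

lemma IsFiltrationBrownian.aemeasurable_uncurry {Ω : Type*} {mΩ : MeasurableSpace Ω}
    {P : Measure Ω} {𝓕 : Filtration ℝ≥0 mΩ} {B : ℝ≥0 → Ω → ℝ} (h𝓕 : UsualConditions P 𝓕)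
    (hB : IsFiltrationBrownian P 𝓕 B) (ν : Measure ℝ) [SFinite ν] :
    AEMeasurable (fun p : Ω × ℝ => B p.2.toNNReal p.1) (P.prod ν) := by
  classical
  have hN : MeasurableSet {ω | ¬ Continuous (B · ω)} :=
    𝓕.le 0 _ (hB.measurableSet_not_continuous h𝓕 0)
  -- Paths are continuous only almost surely; setting the exceptional ones to zero gives a jointly
  -- measurable version.
  have hC : Measurable (Function.uncurry fun (t : ℝ≥0) ω =>
      if ¬ Continuous (B · ω) then 0 else B t ω) := by
    refine measurable_uncurry_of_continuous_of_measurable (fun ω => ?_) fun t =>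
      Measurable.ite hN measurable_const ((hB.adapted t).mono (𝓕.le t) le_rfl)
    by_cases h : Continuous (B · ω) <;> simp [h, continuous_const]
  refine ⟨_, hC.comp (measurable_snd.real_toNNReal.prodMk measurable_fst), ?_⟩
  filter_upwards [Measure.quasiMeasurePreserving_fst.ae hB.brownian.cont] with p hp
  simp [hp]

/-! ### Integrability of the running gain and rewards of a fixed stopping time. -/

namespace RetirementModel

lemma θ_pos (M : RetirementModel) : 0 < M.θ := div_pos (sub_pos.2 M.r_lt_μ) M.σ_pos

variable (M : RetirementModel)
variable {Ω : Type*} {mΩ : MeasurableSpace Ω} {P : Measure Ω} [IsProbabilityMeasure P]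
  {𝓕 : Filtration ℝ≥0 mΩ} {B : ℝ≥0 → Ω → ℝ}

lemma stateDensity_pos (t : ℝ≥0) (ω : Ω) : 0 < M.stateDensity B t ω := Real.exp_pos _

lemma dualState_pos {y : ℝ} (hy : 0 < y) (t : ℝ≥0) (ω : Ω) : 0 < M.dualState B y t ω :=
  mul_pos (mul_pos hy (Real.exp_pos _)) (M.stateDensity_pos t ω)

lemma dualState_mono {y z : ℝ} (h : y ≤ z) (t : ℝ≥0) (ω : Ω) :
    M.dualState B y t ω ≤ M.dualState B z t ω :=
  mul_le_mul_of_nonneg_right (mul_le_mul_of_nonneg_right h (Real.exp_pos _).le)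
    (M.stateDensity_pos t ω).le

lemma continuous_dualState (y : ℝ) {ω : Ω} (h : Continuous (B · ω)) :
    Continuous (M.dualState B y · ω) := by
  unfold dualState stateDensity
  fun_prop

lemma runningGain_eq {y : ℝ} (hy : 0 < y) (ω : Ω) {s : ℝ} (hs : 0 ≤ s) :
    M.runningGain B y ω s = y * (M.stateDensity B s.toNNReal ω *
      M.gainRate (M.dualState B y s.toNNReal ω)) := by
  rw [runningGain, gain_eq_mul_gainRate M (M.dualState_pos hy _ _)]
  nth_rw 1 [dualState]
  rw [Real.coe_toNNReal s hs, Real.exp_neg]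
  have := Real.exp_pos (M.β * s)
  field_simp

lemma abs_runningGain_le {y : ℝ} (hy : 0 < y) (ω : Ω) {s : ℝ} (hs : 0 ≤ s) :
    |M.runningGain B y ω s| ≤
      y * (M.Y + M.criticalIncome) * M.stateDensity B s.toNNReal ω := by
  rw [runningGain_eq M hy ω hs, abs_mul, abs_mul, abs_of_pos hy, abs_of_pos (M.stateDensity_pos _ _),
    mul_assoc, mul_comm (M.Y + _)]
  exact mul_le_mul_of_nonneg_left (mul_le_mul_of_nonneg_left
    (M.abs_gainRate_le (M.dualState_pos hy _ _)) (M.stateDensity_pos _ _).le) hy.le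

lemma runningGain_nonneg {y : ℝ} {ω : Ω} {s : ℝ}
    (h : 0 ≤ M.gain (M.dualState B y s.toNNReal ω)) : 0 ≤ M.runningGain B y ω s :=
  mul_nonneg (Real.exp_pos _).le h

lemma runningGain_pos {y : ℝ} {ω : Ω} {s : ℝ}
    (h : 0 < M.gain (M.dualState B y s.toNNReal ω)) : 0 < M.runningGain B y ω s :=
  mul_pos (Real.exp_pos _) h

omit [IsProbabilityMeasure P] in
lemma aemeasurable_runningGain (h𝓕 : UsualConditions P 𝓕) (hB : IsFiltrationBrownian P 𝓕 B)
    {y : ℝ} (hy : 0 < y) (ν : Measure ℝ) [SFinite ν] :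
    AEMeasurable (fun p : Ω × ℝ => M.runningGain B y p.1 p.2) (P.prod ν) := by
  have hgain : ContinuousOn M.gain (Set.Ioi 0) :=
    (continuousOn_id.mul M.continuousOn_gainRate).congr fun y hy => M.gain_eq_mul_gainRate hy
  have hΦ : Continuous fun q : ℝ × ℝ => Real.exp (-(M.β * q.2)) *
      M.gain (y * Real.exp (M.β * q.2.toNNReal) *
        Real.exp (-(M.r + M.θ ^ 2 / 2) * q.2.toNNReal - M.θ * q.1)) :=
    (by fun_prop : Continuous fun q : ℝ × ℝ => Real.exp (-(M.β * q.2))).mul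
      (hgain.comp_continuous (by fun_prop) fun q => by
        exact mul_pos (mul_pos hy (Real.exp_pos _)) (Real.exp_pos _))
  exact hΦ.measurable.comp_aemeasurable
    ((hB.aemeasurable_uncurry h𝓕 ν).prodMk measurable_snd.aemeasurable)

omit [IsProbabilityMeasure P] in
lemma integrable_stateDensity (hB : IsFiltrationBrownian P 𝓕 B) (t : ℝ≥0) :
    Integrable (M.stateDensity B t) P := by
  have h : Integrable (fun x => Real.exp (-M.θ * x)) (P.map (B t)) := by
    rw [(hB.brownian.hasLaw_eval t).map_eq]
    exact integrable_exp_mul_gaussianReal _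
  replace h := h.comp_aemeasurable (hB.brownian.aemeasurable t)
  refine (h.const_mul (Real.exp (-(M.r + M.θ ^ 2 / 2) * t))).congr (ae_of_all _ fun ω => ?_)
  simp only [stateDensity, Function.comp_apply]
  rw [← Real.exp_add]
  ring_nf

-- The Gaussian moment generating function at `-θ` contributes `e^{θ² t / 2}`, which cancels the `θ²
-- / 2` in the exponent of `H_t`.
omit [IsProbabilityMeasure P] in
lemma integral_stateDensity (hB : IsFiltrationBrownian P 𝓕 B) (t : ℝ≥0) :
    ∫ ω, M.stateDensity B t ω ∂P = Real.exp (-M.r * t) := by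
  have h := mgf_gaussianReal (hB.brownian.hasLaw_eval t).map_eq (-M.θ)
  rw [mgf] at h
  have : ∀ ω, M.stateDensity B t ω =
      Real.exp (-(M.r + M.θ ^ 2 / 2) * t) * Real.exp (-M.θ * B t ω) := fun ω => by
    rw [stateDensity, ← Real.exp_add]
    ring_nf
  simp_rw [this]
  rw [integral_const_mul, h, ← Real.exp_add]
  ring_nf

omit [IsProbabilityMeasure P] in
lemma ae_prod_Ici_nonneg : ∀ᵐ p : Ω × ℝ ∂P.prod (volume.restrict (Set.Ici 0)), 0 ≤ p.2 :=
  Measure.quasiMeasurePreserving_snd.ae (ae_restrict_mem measurableSet_Ici)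

lemma integrable_prod_stateDensity (h𝓕 : UsualConditions P 𝓕) (hB : IsFiltrationBrownian P 𝓕 B) :
    Integrable (fun p : Ω × ℝ => M.stateDensity B p.2.toNNReal p.1)
      (P.prod (volume.restrict (Set.Ici 0))) := by
  have hmeas : AEMeasurable (fun p : Ω × ℝ => M.stateDensity B p.2.toNNReal p.1)
      (P.prod (volume.restrict (Set.Ici 0))) := by
    have hB' := hB.aemeasurable_uncurry h𝓕 (volume.restrict (Set.Ici 0))
    have h2 : AEMeasurable (fun p : Ω × ℝ => (p.2.toNNReal : ℝ))
      (P.prod (volume.restrict (Set.Ici 0))) := by fun_prop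
    exact Real.measurable_exp.comp_aemeasurable ((h2.const_mul _).sub (hB'.const_mul _))
  rw [integrable_prod_iff' hmeas.aestronglyMeasurable]
  refine ⟨ae_of_all _ fun s => M.integrable_stateDensity hB s.toNNReal, ?_⟩
  have h := (integrableOn_Ici_iff_integrableOn_Ioi).2 (exp_neg_integrableOn_Ioi 0 M.r_pos)
  refine Integrable.congr h ?_
  filter_upwards [ae_restrict_mem measurableSet_Ici] with s hs
  simp_rw [Real.norm_of_nonneg (M.stateDensity_pos _ _).le]
  rw [integral_stateDensity M hB, Real.coe_toNNReal s hs]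

lemma integrable_runningGain (h𝓕 : UsualConditions P 𝓕) (hB : IsFiltrationBrownian P 𝓕 B)
    {y : ℝ} (hy : 0 < y) : Integrable (fun p : Ω × ℝ => M.runningGain B y p.1 p.2)
      (P.prod (volume.restrict (Set.Ici 0))) := by
  refine ((M.integrable_prod_stateDensity h𝓕 hB).const_mul (y * (M.Y + M.criticalIncome))).mono'
    (M.aemeasurable_runningGain h𝓕 hB hy _).aestronglyMeasurable ?_
  filter_upwards [ae_prod_Ici_nonneg] with p hp
  exact M.abs_runningGain_le hy _ hp

/-- The pairs of a scenario and a time strictly before `τ`. -/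
def beforeStopping (τ : Ω → WithTop ℝ≥0) : Set (Ω × ℝ) :=
  {p | 0 ≤ p.2 ∧ (p.2.toNNReal : WithTop ℝ≥0) < τ p.1}

/-- For `s ≥ 0`, `s < τ` holds iff some rational `q` has `s ≤ q < τ`, so the set is built from
countably many measurable rectangles. -/
lemma measurableSet_beforeStopping {τ : Ω → WithTop ℝ≥0} (hτ : IsStoppingTime 𝓕 τ) :
    MeasurableSet (beforeStopping τ) := by
  have : beforeStopping τ = {p | 0 ≤ p.2} ∩ ⋃ q : ℚ,
      {ω | ((q : ℝ).toNNReal : WithTop ℝ≥0) < τ ω} ×ˢ {s : ℝ | s.toNNReal ≤ (q : ℝ).toNNReal} := by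
    ext ⟨ω, s⟩
    simp only [beforeStopping, Set.mem_ofPred_eq, Set.mem_inter_iff, Set.mem_iUnion, Set.mem_prod]
    refine and_congr_right fun hs => ⟨fun h => ?_, ?_⟩
    · cases hτω : τ ω with
      | top =>
        obtain ⟨q, hq⟩ := exists_rat_gt s
        exact ⟨q, WithTop.coe_lt_top _, Real.toNNReal_le_toNNReal hq.le⟩
      | coe t =>
        rw [hτω, WithTop.coe_lt_coe, Real.toNNReal_lt_iff_lt_coe hs] at h
        obtain ⟨q, hsq, hqt⟩ := exists_rat_btwn h
        exact ⟨q, WithTop.coe_lt_coe.2 ((Real.toNNReal_lt_iff_lt_coe (hs.trans hsq.le)).2 hqt),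
          Real.toNNReal_le_toNNReal hsq.le⟩
    · rintro ⟨q, hq, hsq⟩
      exact (WithTop.coe_le_coe.2 hsq).trans_lt hq
  rw [this]
  refine (measurable_snd measurableSet_Ici).inter (MeasurableSet.iUnion fun q => ?_)
  exact (𝓕.le _ _ (hτ.measurableSet_gt _)).prod (measurableSet_le (by fun_prop) (by fun_prop))

/-- Fubini turns the reward into one integral over a domain that does not depend on `y`, so rewards
from different starting points can be compared pointwise. -/
lemma reward_eq_setIntegral (h𝓕 : UsualConditions P 𝓕) (hB : IsFiltrationBrownian P 𝓕 B)
    {y : ℝ} (hy : 0 < y) {τ : Ω → WithTop ℝ≥0} (hτ : IsStoppingTime 𝓕 τ) :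
    M.reward P B y τ = ∫ p in beforeStopping τ, M.runningGain B y p.1 p.2
      ∂(P.prod (volume.restrict (Set.Ici 0))) := by
  have hS := measurableSet_beforeStopping hτ
  rw [← integral_indicator hS,
    integral_prod _ ((M.integrable_runningGain h𝓕 hB hy).indicator hS), reward]
  congr 1 with ω
  have hSω : MeasurableSet {s : ℝ | 0 ≤ s ∧ (s.toNNReal : WithTop ℝ≥0) < τ ω} :=
    measurable_prodMk_left hS
  rw [← integral_indicator hSω, ← integral_indicator measurableSet_Ici]
  congr 1 with s
  simp only [Set.indicator, beforeStopping, Set.mem_ofPred_eq, Set.mem_Ici]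
  split_ifs <;> simp_all

lemma reward_div_mono (h𝓕 : UsualConditions P 𝓕) (hB : IsFiltrationBrownian P 𝓕 B)
    {y z : ℝ} (hy : 0 < y) (hyz : y ≤ z) {τ : Ω → WithTop ℝ≥0} (hτ : IsStoppingTime 𝓕 τ) :
    M.reward P B y τ / y ≤ M.reward P B z τ / z := by
  have hz := hy.trans_le hyz
  rw [reward_eq_setIntegral M h𝓕 hB hy hτ, reward_eq_setIntegral M h𝓕 hB hz hτ,
    ← integral_div, ← integral_div]
  refine integral_mono_ae ((M.integrable_runningGain h𝓕 hB hy).integrableOn.div_const _)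
    ((M.integrable_runningGain h𝓕 hB hz).integrableOn.div_const _) ?_
  filter_upwards [ae_restrict_of_ae ae_prod_Ici_nonneg] with p hp
  rw [runningGain_eq M hy _ hp, runningGain_eq M hz _ hp, mul_div_cancel_left₀ _ hy.ne',
    mul_div_cancel_left₀ _ hz.ne']
  exact mul_le_mul_of_nonneg_left (M.monotoneOn_gainRate (M.dualState_pos hy _ _)
    (M.dualState_pos hz _ _) (M.dualState_mono hyz _ _)) (M.stateDensity_pos _ _).le

/-- Dominated convergence: for `z < y + 1` the integrand is bounded by a fixed multiple of the
integrable state density. -/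
lemma continuousAt_reward (h𝓕 : UsualConditions P 𝓕) (hB : IsFiltrationBrownian P 𝓕 B)
    {y : ℝ} (hy : 0 < y) {τ : Ω → WithTop ℝ≥0} (hτ : IsStoppingTime 𝓕 τ) :
    ContinuousAt (fun z => M.reward P B z τ) y := by
  have hpos : ∀ᶠ z in nhds y, 0 < z := lt_mem_nhds hy
  have hC : 0 ≤ M.Y + M.criticalIncome := (add_pos M.Y_pos M.criticalIncome_pos).le
  refine ContinuousAt.congr (f := fun z => ∫ p in beforeStopping τ, M.runningGain B z p.1 p.2
      ∂(P.prod (volume.restrict (Set.Ici 0)))) ?_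
    (hpos.mono fun z hz => (M.reward_eq_setIntegral h𝓕 hB hz hτ).symm)
  refine continuousAt_of_dominated
    (bound := fun p => (y + 1) * (M.Y + M.criticalIncome) * M.stateDensity B p.2.toNNReal p.1)
    ?_ ?_ ((M.integrable_prod_stateDensity h𝓕 hB).const_mul _).integrableOn ?_
  · exact hpos.mono fun z hz => (M.integrable_runningGain h𝓕 hB hz).integrableOn.1
  · filter_upwards [hpos, gt_mem_nhds (lt_add_one y)] with z hz hz'
    filter_upwards [ae_restrict_of_ae ae_prod_Ici_nonneg] with p hp
    refine (M.abs_runningGain_le hz _ hp).trans ?_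
    exact mul_le_mul_of_nonneg_right (mul_le_mul_of_nonneg_right (le_of_lt hz') hC)
      (M.stateDensity_pos _ _).le
  · filter_upwards [ae_restrict_of_ae ae_prod_Ici_nonneg] with p hp
    refine ContinuousAt.congr (f := fun z => z * (M.stateDensity B p.2.toNNReal p.1 *
      M.gainRate (M.dualState B z p.2.toNNReal p.1))) ?_
      (hpos.mono fun z hz => (M.runningGain_eq hz _ hp).symm)
    have h1 : ContinuousAt M.gainRate (M.dualState B y p.2.toNNReal p.1) :=
      M.continuousOn_gainRate.continuousAt (Ioi_mem_nhds (M.dualState_pos hy _ _))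
    have h2 : ContinuousAt (fun z => M.dualState B z p.2.toNNReal p.1) y := by
      unfold dualState; fun_prop
    exact continuousAt_id.mul (continuousAt_const.mul (h1.comp (f := fun z => M.dualState B z p.2.toNNReal p.1) h2))

omit [IsProbabilityMeasure P] in
lemma reward_zero (y : ℝ) : M.reward P B y (fun _ => ((0 : ℝ≥0) : WithTop ℝ≥0)) = 0 := by
  have : {s : ℝ | 0 ≤ s ∧ (s.toNNReal : WithTop ℝ≥0) < ((0 : ℝ≥0) : WithTop ℝ≥0)} = ∅ :=
    Set.eq_empty_of_forall_notMem fun s hs => not_lt_bot (WithTop.coe_lt_coe.1 hs.2)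
  simp only [reward, this, setIntegral_empty, integral_zero]

omit [IsProbabilityMeasure P] in
lemma reward_congr {y : ℝ} {τ ρ : Ω → WithTop ℝ≥0} (h : τ =ᵐ[P] ρ) :
    M.reward P B y τ = M.reward P B y ρ :=
  integral_congr_ae (h.mono fun ω hω => by simp only [hω])

/-! ### The value and its zero set. -/

omit [IsProbabilityMeasure P] in
lemma reward_le_value (y : ℝ) {τ : Ω → WithTop ℝ≥0} (hτ : IsStoppingTime 𝓕 τ) :
    (M.reward P B y τ : EReal) ≤ M.value P 𝓕 B y :=
  le_iSup₂_of_le (f := fun (τ : Ω → WithTop ℝ≥0) (_ : IsStoppingTime 𝓕 τ) =>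
    (M.reward P B y τ : EReal)) τ hτ le_rfl

omit [IsProbabilityMeasure P] in
lemma value_nonneg (y : ℝ) : 0 ≤ M.value P 𝓕 B y := by
  have := M.reward_le_value (P := P) (B := B) y (isStoppingTime_const 𝓕 (0 : ℝ≥0))
  rwa [reward_zero] at this

omit [IsProbabilityMeasure P] in
lemma value_eq_zero_iff (y : ℝ) : M.value P 𝓕 B y = 0 ↔
    ∀ τ : Ω → WithTop ℝ≥0, IsStoppingTime 𝓕 τ → M.reward P B y τ ≤ 0 := by
  refine ⟨fun h τ hτ => ?_, fun h => le_antisymm ?_ (M.value_nonneg y)⟩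
  · exact_mod_cast h ▸ M.reward_le_value (P := P) (B := B) y hτ
  · exact iSup₂_le fun τ hτ => by exact_mod_cast h τ hτ

lemma value_eq_zero_of_le (h𝓕 : UsualConditions P 𝓕) (hB : IsFiltrationBrownian P 𝓕 B)
    {y z : ℝ} (hy : 0 < y) (hyz : y ≤ z) (h : M.value P 𝓕 B z = 0) : M.value P 𝓕 B y = 0 := by
  rw [value_eq_zero_iff] at h ⊢
  intro τ hτ
  have hz := hy.trans_le hyz
  have := (M.reward_div_mono h𝓕 hB hy hyz hτ).trans (div_nonpos_of_nonpos_of_nonneg (h τ hτ) hz.le)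
  simpa using (div_le_iff₀ hy).1 this

/-- Value zero means `J(·, τ) ≤ 0` for every `τ`, a condition that passes to limits; so the
threshold itself, if positive and finite, belongs to the region. -/
lemma value_eq_zero_of_forall_lt (h𝓕 : UsualConditions P 𝓕) (hB : IsFiltrationBrownian P 𝓕 B)
    {y : ℝ} (hy : 0 < y) (h : ∀ z, 0 < z → z < y → M.value P 𝓕 B z = 0) :
    M.value P 𝓕 B y = 0 := by
  rw [value_eq_zero_iff]
  intro τ hτ
  refine le_of_tendsto ((M.continuousAt_reward h𝓕 hB hy hτ).tendsto.mono_left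
    (nhdsWithin_le_nhds (s := Set.Iio y))) ?_
  filter_upwards [Ioo_mem_nhdsLT hy] with z hz
  exact (M.value_eq_zero_iff z).1 (h z hz.1 hz.2) τ hτ

lemma value_eq_zero_iff_le_retirementThreshold (h𝓕 : UsualConditions P 𝓕)
    (hB : IsFiltrationBrownian P 𝓕 B) {y : ℝ} (hy : 0 < y) :
    M.value P 𝓕 B y = 0 ↔ ENNReal.ofReal y ≤ M.retirementThreshold P 𝓕 B := by
  refine ⟨fun h => le_iSup₂_of_le (f := fun (y : ℝ) (_ : y ∈ M.retirementRegion P 𝓕 B) =>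
    ENNReal.ofReal y) y ⟨hy, h⟩ le_rfl, fun h => ?_⟩
  refine M.value_eq_zero_of_forall_lt h𝓕 hB hy fun z hz hzy => ?_
  obtain ⟨x, hzx⟩ := lt_iSup_iff.1 (((ENNReal.ofReal_lt_ofReal_iff hy).2 hzy).trans_le h)
  obtain ⟨hx, hzx⟩ := lt_iSup_iff.1 hzx
  exact M.value_eq_zero_of_le h𝓕 hB hz ((ENNReal.ofReal_lt_ofReal_iff hx.1).1 hzx).le hx.2

/-! ### Positive reward of never retiring. -/

lemma reward_pos (h𝓕 : UsualConditions P 𝓕) (hB : IsFiltrationBrownian P 𝓕 B)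
    {y : ℝ} (hy : 0 < y) {τ : Ω → WithTop ℝ≥0} (hτ : IsStoppingTime 𝓕 τ)
    (hnonneg : ∀ p ∈ beforeStopping τ, 0 ≤ M.runningGain B y p.1 p.2)
    (hpos : P.prod (volume.restrict (Set.Ici 0))
      ({p | 0 < M.runningGain B y p.1 p.2} ∩ beforeStopping τ) ≠ 0) :
    0 < M.reward P B y τ := by
  have hS := measurableSet_beforeStopping hτ
  rw [reward_eq_setIntegral M h𝓕 hB hy hτ, setIntegral_pos_iff_support_of_nonneg_ae
    (ae_restrict_of_forall_mem hS hnonneg) (M.integrable_runningGain h𝓕 hB hy).integrableOn]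
  exact (pos_iff_ne_zero.2 hpos).trans_le
    (measure_mono (Set.inter_subset_inter_left _ fun p hp => ne_of_gt hp))

lemma isStoppingTime_top : IsStoppingTime 𝓕 (fun _ : Ω => (⊤ : WithTop ℝ≥0)) :=
  fun t => by simp

/-- At critical income the gain vanishes on `(0, A(Lhigh)]`, so strict positivity needs `y_s` to
exceed `A(Lhigh)` with positive probability; the Gaussian law of `B_s` ensures this. -/
lemma reward_top_pos (h𝓕 : UsualConditions P 𝓕) (hB : IsFiltrationBrownian P 𝓕 B)
    (h : M.criticalIncome ≤ M.Y) {y : ℝ} (hy : 0 < y) :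
    0 < M.reward P B y fun _ => ⊤ := by
  refine M.reward_pos h𝓕 hB hy isStoppingTime_top
    (fun p _ => M.runningGain_nonneg (M.gain_nonneg h (M.dualState_pos hy _ _))) fun h0 => ?_
  have hae := measure_eq_zero_iff_ae_notMem.1 h0
  rw [← Measure.prod_swap] at hae
  replace hae := ae_restrict_of_ae_restrict_of_subset Set.Ioi_subset_Ici_self
    (Measure.ae_ae_of_ae_prod (ae_of_ae_map measurable_swap.aemeasurable hae))
  have : (ae (volume.restrict (Set.Ioi (0 : ℝ)))).NeBot := ae_restrict_neBot.2 (by simp)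
  obtain ⟨s, hs, hs0⟩ := (hae.and (ae_restrict_mem measurableSet_Ioi)).exists
  have hs0 : 0 < s := hs0
  have hθ := M.θ_pos
  -- The level for which `B_s < c` amounts to `y_s > A(Lhigh)`.
  set c := -((Real.log (M.A M.Lhigh / (y * Real.exp (M.β * s.toNNReal))) +
    (M.r + M.θ ^ 2 / 2) * s.toNNReal) / M.θ) with hc
  have hB0 : ∀ᵐ ω ∂P, c ≤ B s.toNNReal ω := by
    filter_upwards [hs] with ω hω
    by_contra! hlt
    refine hω ⟨M.runningGain_pos (M.gain_pos h ?_), hs0.le, WithTop.coe_lt_top _⟩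
    have hye : 0 < y * Real.exp (M.β * s.toNNReal) := mul_pos hy (Real.exp_pos _)
    rw [hc, lt_neg, div_lt_iff₀ hθ] at hlt
    rw [Prod.fst_swap, Prod.snd_swap, dualState, stateDensity, ← div_lt_iff₀' hye,
      ← Real.log_lt_iff_lt_exp (div_pos (M.A_pos _) hye)]
    linarith
  have hlaw := hB.brownian.hasLaw_eval s.toNNReal
  have h1 : gaussianReal 0 s.toNNReal (Set.Iio c) = 0 := by
    rw [← hlaw.map_eq, Measure.map_apply_of_aemeasurable hlaw.aemeasurable measurableSet_Iio]
    simpa [ae_iff, Set.preimage, Set.mem_Iio] using hB0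
  -- Lebesgue measure is absolutely continuous with respect to a nondegenerate Gaussian, so the
  -- half-line below `c` would be Lebesgue-null.
  have h2 := gaussianReal_absolutelyContinuous' 0 (Real.toNNReal_pos.2 hs0).ne' h1
  simp at h2

end RetirementModel
-- Threshold times.
namespace RetirementModel

variable (M : RetirementModel)
variable {Ω : Type*} {mΩ : MeasurableSpace Ω} {P : Measure Ω}
  {𝓕 : Filtration ℝ≥0 mΩ} {B : ℝ≥0 → Ω → ℝ}

lemma thresholdTime_zero {y : ℝ} (hy : 0 < y) : M.thresholdTime B y 0 = fun _ => ⊤ := by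
  ext1 ω
  rw [thresholdTime, hittingAfter_eq_top_iff]
  intro t _ h
  exact absurd (ENNReal.ofReal_eq_zero.1 (le_antisymm h zero_le)) (not_le.2 (M.dualState_pos hy t ω))

lemma thresholdTime_eq_zero {y : ℝ} {b : ℝ≥0∞} {ω : Ω}
    (h : ENNReal.ofReal (M.dualState B y 0 ω) ≤ b) :
    M.thresholdTime B y b ω = ((0 : ℝ≥0) : WithTop ℝ≥0) :=
  le_antisymm (hittingAfter_le_of_mem le_rfl h) bot_le

lemma dualState_zero (hB : IsFiltrationBrownian P 𝓕 B) (y : ℝ) :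
    ∀ᵐ ω ∂P, M.dualState B y 0 ω = y := by
  filter_upwards [hB.brownian.eval_zero_ae_eq_zero] with ω hω
  simp [dualState, stateDensity, hω]

lemma lt_dualState_of_lt_thresholdTime {y j : ℝ} {t : ℝ≥0} {ω : Ω}
    (h : t < M.thresholdTime B y (ENNReal.ofReal j) ω) : j < M.dualState B y t ω := by
  by_contra! hle
  exact notMem_of_lt_hittingAfter h zero_le (ENNReal.ofReal_le_ofReal hle)

/-- On a continuous path the set of times with `y_s ≤ j` is closed, so the infimum is attained. -/
lemma thresholdTime_le_iff {y j : ℝ} (hj : 0 ≤ j) (t : ℝ≥0) {ω : Ω} (hω : Continuous (B · ω)) :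
    M.thresholdTime B y (ENNReal.ofReal j) ω ≤ t ↔ ∃ s ≤ t, M.dualState B y s ω ≤ j := by
  have hset : {i : ℝ≥0 | 0 ≤ i ∧ M.dualState B y i ω ∈ {z : ℝ | ENNReal.ofReal z ≤ ENNReal.ofReal j}}
      = {i : ℝ≥0 | M.dualState B y i ω ≤ j} := by
    ext i
    simp [ENNReal.ofReal_le_ofReal_iff hj]
  refine ⟨fun h => ?_, fun ⟨s, hst, hs⟩ => (hittingAfter_le_of_mem zero_le
    (ENNReal.ofReal_le_ofReal hs)).trans (WithTop.coe_le_coe.2 hst)⟩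
  rw [thresholdTime, hittingAfter] at h
  split_ifs at h with hex
  · rw [hset, WithTop.coe_le_coe] at h
    obtain ⟨i, -, hi⟩ := hex
    have hclosed : IsClosed {i : ℝ≥0 | M.dualState B y i ω ≤ j} :=
      isClosed_le (M.continuous_dualState y hω) continuous_const
    exact ⟨_, h, hclosed.csInf_mem ⟨i, (ENNReal.ofReal_le_ofReal_iff hj).1 hi⟩ (OrderBot.bddBelow _)⟩
  · exact absurd h (WithTop.coe_lt_top t).not_ge

lemma thresholdTime_pos (hB : IsFiltrationBrownian P 𝓕 B) {y j : ℝ} (hj : 0 ≤ j) (hjy : j < y) :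
    ∀ᵐ ω ∂P, ((0 : ℝ≥0) : WithTop ℝ≥0) < M.thresholdTime B y (ENNReal.ofReal j) ω := by
  filter_upwards [hB.brownian.cont, M.dualState_zero hB y] with ω hω h0
  by_contra! h
  obtain ⟨s, hs, hsj⟩ := (M.thresholdTime_le_iff hj 0 hω).1 h
  rw [le_antisymm hs zero_le, h0] at hsj
  linarith

/-- A continuous path reaches `(-∞, j]` up to time `t` iff it comes arbitrarily close to `j`, or
below, at countably many times. -/
lemma exists_le_iff_forall_exists_rat {f : ℝ≥0 → ℝ} (hf : Continuous f) (t : ℝ≥0) (j : ℝ) :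
    (∃ s ≤ t, f s ≤ j) ↔ ∀ n : ℕ, ∃ q : ℚ, f (min (q : ℝ).toNNReal t) < j + 1 / (n + 1) := by
  constructor
  · rintro ⟨s, hst, hs⟩ n
    have hopen : IsOpen {x : ℝ | f (min x.toNNReal t) < j + 1 / (n + 1)} :=
      isOpen_lt (by fun_prop) continuous_const
    refine Rat.denseRange_cast.exists_mem_open hopen ⟨s, ?_⟩
    rw [Set.mem_ofPred_eq, Real.toNNReal_coe, min_eq_left hst]
    exact hs.trans_lt (lt_add_of_pos_right _ Nat.one_div_pos_of_nat)
  · intro h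
    obtain ⟨s, hs, hmin⟩ := (isCompact_Icc (a := (0 : ℝ≥0)) (b := t)).exists_isMinOn
      ⟨0, le_rfl, zero_le⟩ hf.continuousOn
    refine ⟨s, hs.2, le_of_forall_pos_le_add fun ε hε => ?_⟩
    obtain ⟨n, hn⟩ := exists_nat_one_div_lt hε
    obtain ⟨q, hq⟩ := h n
    have := isMinOn_iff.1 hmin (min (q : ℝ).toNNReal t) ⟨zero_le, min_le_right _ _⟩
    linarith

/-- On continuous paths the event reduces to countably many times; its part on the other paths is
null, hence in `𝓕 0` by completeness. -/
lemma isStoppingTime_thresholdTime (h𝓕 : UsualConditions P 𝓕) (hB : IsFiltrationBrownian P 𝓕 B)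
    {j : ℝ} (hj : 0 ≤ j) (y : ℝ) :
    IsStoppingTime 𝓕 (M.thresholdTime B y (ENNReal.ofReal j)) := by
  intro t
  set N := {ω | ¬ Continuous (B · ω)} with hN
  have hNt : MeasurableSet[𝓕 t] N := hB.measurableSet_not_continuous h𝓕 t
  have hNsub : MeasurableSet[𝓕 t] ({ω | M.thresholdTime B y (ENNReal.ofReal j) ω ≤ t} ∩ N) :=
    𝓕.mono (zero_le (a := t)) _
      (h𝓕.complete _ (measure_mono_null Set.inter_subset_right hB.brownian.cont))
  have hgood : MeasurableSet[𝓕 t]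
      (⋂ n : ℕ, ⋃ q : ℚ, {ω | M.dualState B y (min (q : ℝ).toNNReal t) ω < j + 1 / (n + 1)}) := by
    refine MeasurableSet.iInter fun n => MeasurableSet.iUnion fun q => ?_
    -- Truncating the rational time at `t` keeps the event in `𝓕 t`.
    have hBm : Measurable[𝓕 t] (B (min (q : ℝ).toNNReal t)) :=
      (hB.adapted _).mono (𝓕.mono (min_le_right _ _)) le_rfl
    have : Measurable[𝓕 t] (M.dualState B y (min (q : ℝ).toNNReal t)) :=
      (Real.measurable_exp.comp ((hBm.const_mul M.θ).const_sub _)).const_mul _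
    exact this measurableSet_Iio
  have : {ω | M.thresholdTime B y (ENNReal.ofReal j) ω ≤ t} =
      ({ω | M.thresholdTime B y (ENNReal.ofReal j) ω ≤ t} ∩ N) ∪
      ((⋂ n : ℕ, ⋃ q : ℚ, {ω | M.dualState B y (min (q : ℝ).toNNReal t) ω < j + 1 / (n + 1)}) \ N) := by
    ext ω
    by_cases hω : Continuous (B · ω)
    · simp only [Set.mem_union, Set.mem_inter_iff, Set.mem_sdiff, Set.mem_iInter, Set.mem_iUnion,
        Set.mem_ofPred_eq, hN, hω, not_true_eq_false, and_false, false_or, not_false_eq_true,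
        and_true]
      rw [M.thresholdTime_le_iff hj t hω,
        exists_le_iff_forall_exists_rat (M.continuous_dualState y hω) t j]
    · simp [hN, hω]
  rw [this]
  exact hNsub.union (hgood.diff hNt)

variable [IsProbabilityMeasure P]

/-- The gain is strictly positive before the hitting time, and that time is almost surely positive
because the path starts strictly above `j` and is continuous. -/
lemma reward_thresholdTime_pos (h𝓕 : UsualConditions P 𝓕) (hB : IsFiltrationBrownian P 𝓕 B)
    {y j : ℝ} (hj : 0 ≤ j) (hjy : j < y) (hgain : ∀ z, j < z → 0 < M.gain z) :
    0 < M.reward P B y (M.thresholdTime B y (ENNReal.ofReal j)) := by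
  have hτ := M.isStoppingTime_thresholdTime h𝓕 hB hj y
  have hpos : ∀ p ∈ beforeStopping (M.thresholdTime B y (ENNReal.ofReal j)),
      0 < M.runningGain B y p.1 p.2 := fun p hp =>
    M.runningGain_pos (hgain _ (M.lt_dualState_of_lt_thresholdTime hp.2))
  refine M.reward_pos h𝓕 hB (hj.trans_lt hjy) hτ (fun p hp => (hpos p hp).le) ?_
  rw [Set.inter_eq_right.2 (show _ ⊆ {p : Ω × ℝ | 0 < M.runningGain B y p.1 p.2} from hpos), Ne,
    Measure.measure_prod_null (measurableSet_beforeStopping hτ)]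
  intro h
  obtain ⟨ω, hω, hω0⟩ := (h.and (M.thresholdTime_pos hB hj hjy)).exists
  obtain ⟨t, ht0, ht⟩ : ∃ t : ℝ, 0 < t ∧
      (t.toNNReal : WithTop ℝ≥0) ≤ M.thresholdTime B y (ENNReal.ofReal j) ω := by
    cases hc : M.thresholdTime B y (ENNReal.ofReal j) ω with
    | top => exact ⟨1, one_pos, le_top⟩
    | coe t =>
      rw [hc, WithTop.coe_lt_coe] at hω0
      exact ⟨t, hω0, by rw [Real.toNNReal_coe]⟩
  have hsub : Set.Ioo 0 t ⊆
      Prod.mk ω ⁻¹' beforeStopping (M.thresholdTime B y (ENNReal.ofReal j)) := fun s hs =>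
    ⟨hs.1.le, (WithTop.coe_lt_coe.2 ((Real.toNNReal_lt_toNNReal_iff ht0).2 hs.2)).trans_le ht⟩
  have h0 := measure_mono_null hsub hω
  rw [Measure.restrict_apply measurableSet_Ioo,
    Set.inter_eq_left.2 fun s hs => Set.mem_Ici.2 hs.1.le] at h0
  simp [ht0.not_ge] at h0

/-! ### Finite and zero thresholds. -/

omit [IsProbabilityMeasure P] in
lemma value_pos_of_reward_pos {y : ℝ} {τ : Ω → WithTop ℝ≥0} (hτ : IsStoppingTime 𝓕 τ)
    (h : 0 < M.reward P B y τ) : M.value P 𝓕 B y ≠ 0 :=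
  ((EReal.coe_pos.2 h).trans_le (M.reward_le_value y hτ)).ne'

lemma value_ne_zero (h𝓕 : UsualConditions P 𝓕) (hB : IsFiltrationBrownian P 𝓕 B)
    (h : M.criticalIncome ≤ M.Y) {y : ℝ} (hy : 0 < y) : M.value P 𝓕 B y ≠ 0 :=
  M.value_pos_of_reward_pos isStoppingTime_top (M.reward_top_pos h𝓕 hB h hy)

lemma exists_value_ne_zero (h𝓕 : UsualConditions P 𝓕) (hB : IsFiltrationBrownian P 𝓕 B) :
    ∃ y : ℝ, 0 < y ∧ M.value P 𝓕 B y ≠ 0 := by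
  rcases le_or_gt M.criticalIncome M.Y with h | h
  · exact ⟨1, one_pos, M.value_ne_zero h𝓕 hB h one_pos⟩
  · obtain ⟨j, hAj, -, -, hgain⟩ := M.exists_sign_change h
    have hj := (M.A_pos _).trans hAj
    exact ⟨j + 1, by linarith, M.value_pos_of_reward_pos
      (M.isStoppingTime_thresholdTime h𝓕 hB hj.le _)
      (M.reward_thresholdTime_pos h𝓕 hB hj.le (lt_add_one j) hgain)⟩

lemma retirementThreshold_lt_top (h𝓕 : UsualConditions P 𝓕) (hB : IsFiltrationBrownian P 𝓕 B) :
    M.retirementThreshold P 𝓕 B < ∞ := by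
  obtain ⟨y, hy, hv⟩ := M.exists_value_ne_zero h𝓕 hB
  rw [Ne, value_eq_zero_iff_le_retirementThreshold M h𝓕 hB hy, not_le] at hv
  exact hv.trans ENNReal.ofReal_lt_top

lemma retirementThreshold_eq_zero (h𝓕 : UsualConditions P 𝓕) (hB : IsFiltrationBrownian P 𝓕 B)
    (h : M.criticalIncome ≤ M.Y) : M.retirementThreshold P 𝓕 B = 0 :=
  le_antisymm (iSup₂_le fun _ hy => absurd hy.2 (M.value_ne_zero h𝓕 hB h hy.1)) zero_le

/-- With a nonnegative gain, enlarging the domain of integration can only increase the reward. -/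
lemma isOptimalThreshold_zero (h𝓕 : UsualConditions P 𝓕) (hB : IsFiltrationBrownian P 𝓕 B)
    (h : M.criticalIncome ≤ M.Y) : M.IsOptimalThreshold P 𝓕 B 0 := by
  intro y hy
  rw [thresholdTime_zero M hy]
  refine le_antisymm (M.reward_le_value y isStoppingTime_top) (iSup₂_le fun τ hτ => ?_)
  rw [EReal.coe_le_coe_iff, reward_eq_setIntegral M h𝓕 hB hy hτ,
    reward_eq_setIntegral M h𝓕 hB hy isStoppingTime_top]
  exact setIntegral_mono_set (M.integrable_runningGain h𝓕 hB hy).integrableOn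
    (ae_of_all _ fun p => M.runningGain_nonneg (M.gain_nonneg h (M.dualState_pos hy _ _)))
    (LE.le.eventuallyLE fun p hp => ⟨hp.1, WithTop.coe_lt_top _⟩)

omit [IsProbabilityMeasure P] in
lemma reward_thresholdTime_eq_zero (hB : IsFiltrationBrownian P 𝓕 B) {y : ℝ} {b : ℝ≥0∞}
    (h : ENNReal.ofReal y ≤ b) : M.reward P B y (M.thresholdTime B y b) = 0 := by
  rw [← M.reward_zero (P := P) (B := B) y]
  refine M.reward_congr ?_
  filter_upwards [M.dualState_zero hB y] with ω hω
  exact M.thresholdTime_eq_zero (hω.symm ▸ h)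

-- From `y ≤ b` the rule stops at once almost surely and earns nothing, so optimality of `b` makes
-- the value vanish there.
omit [IsProbabilityMeasure P] in
lemma IsOptimalThreshold.value_eq_zero {M : RetirementModel} (hB : IsFiltrationBrownian P 𝓕 B)
    {b : ℝ≥0∞} (hb : M.IsOptimalThreshold P 𝓕 B b) {y : ℝ} (hy : 0 < y)
    (h : ENNReal.ofReal y ≤ b) : M.value P 𝓕 B y = 0 := by
  rw [← hb y hy, M.reward_thresholdTime_eq_zero hB h, EReal.coe_zero]

end RetirementModel

theorem mainTheorem6 {Ω : Type*} {mΩ : MeasurableSpace Ω} (P : Measure Ω) [IsProbabilityMeasure P]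
    (𝓕 : Filtration ℝ≥0 mΩ) (h𝓕 : UsualConditions P 𝓕)
    (B : ℝ≥0 → Ω → ℝ) (hB : IsFiltrationBrownian P 𝓕 B) (M : RetirementModel) :
    -- the expectations that define the stopping problem converge absolutely
    (∀ y : ℝ, 0 < y → Integrable (fun p : Ω × ℝ => M.runningGain B y p.1 p.2)
      (P.prod (volume.restrict (Set.Ici 0)))) ∧
    -- immediate retirement is optimal exactly up to the threshold
    (∀ y : ℝ, 0 < y →
      (M.value P 𝓕 B y = 0 ↔ ENNReal.ofReal y ≤ M.retirementThreshold P 𝓕 B)) ∧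
    -- the threshold is finite
    M.retirementThreshold P 𝓕 B < ∞ ∧
    -- high income: the gain is nonnegative, the threshold is zero, never retiring is optimal
    (M.criticalIncome ≤ M.Y →
      M.retirementThreshold P 𝓕 B = 0 ∧
      (∀ y : ℝ, 0 < y → 0 ≤ M.gain y) ∧
      M.IsOptimalThreshold P 𝓕 B 0) ∧
    -- low income: the gain changes sign once, and waiting for that level has positive value
    (M.Y < M.criticalIncome →
      ∃! j : ℝ, M.A M.Lhigh < j ∧
        (∀ y : ℝ, 0 < y → y < j → M.gain y < 0) ∧ M.gain j = 0 ∧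
        (∀ y : ℝ, j < y → 0 < M.gain y) ∧
        (∀ y : ℝ, j < y →
          IsStoppingTime 𝓕 (M.thresholdTime B y (ENNReal.ofReal j)) ∧
          0 < M.reward P B y (M.thresholdTime B y (ENNReal.ofReal j)))) ∧
    -- the same for every threshold whose hitting time solves the stopping problem
    (∀ b : ℝ≥0∞, M.IsOptimalThreshold P 𝓕 B b →
      b < ∞ ∧ (M.criticalIncome ≤ M.Y → b = 0)) := by

  refine ⟨fun y hy => M.integrable_runningGain h𝓕 hB hy,
    fun y hy => M.value_eq_zero_iff_le_retirementThreshold h𝓕 hB hy,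
    M.retirementThreshold_lt_top h𝓕 hB,
    fun h => ⟨M.retirementThreshold_eq_zero h𝓕 hB h, fun y hy => M.gain_nonneg h hy,
      M.isOptimalThreshold_zero h𝓕 hB h⟩, fun h => ?_, fun b hb => ⟨?_, fun h => ?_⟩⟩
  · obtain ⟨j, hAj, hneg, hzero, hpos⟩ := M.exists_sign_change h
    have hj := (M.A_pos _).trans hAj
    refine ⟨j, ⟨hAj, hneg, hzero, hpos, fun y hy =>
      ⟨M.isStoppingTime_thresholdTime h𝓕 hB hj.le y,
        M.reward_thresholdTime_pos h𝓕 hB hj.le hy hpos⟩⟩, ?_⟩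
    rintro i ⟨hAi, -, hizero, hipos, -⟩
    -- The smaller of two candidates makes the gain positive at the larger one, where it must
    -- vanish.
    rcases lt_trichotomy i j with hij | hij | hij
    · exact absurd hzero (hipos j hij).ne'
    · exact hij
    · exact absurd hizero (hpos i hij).ne'
  · by_contra! htop
    obtain ⟨y, hy, hv⟩ := M.exists_value_ne_zero h𝓕 hB
    exact hv (hb.value_eq_zero hB hy (le_top.trans htop))
  · by_contra h0
    -- As `b` may be infinite, a finite starting point strictly between `0` and `b` is used.
    obtain ⟨y, hy, hyb⟩ := ENNReal.lt_iff_exists_nnreal_btwn.1 (pos_iff_ne_zero.2 h0)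
    have hy0 : 0 < (y : ℝ) := by exact_mod_cast hy
    exact M.value_ne_zero h𝓕 hB h hy0 (hb.value_eq_zero hB hy0 (by simpa using hyb.le))
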